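/- Let $\beta\mathbb N$ be the Stone–Čech compactification of the discrete space $\mathbb N$, and let $C_p(\beta\mathbb N)$ be the space of continuous real-valued functions on $\beta\mathbb N$ with the topology of pointwise convergence. Let $\ell_\infty=\{x\in\mathbb R^{\mathbb N}:\sup_n|x_n|<\infty\}$ and $c_0=\{x\in\mathbb R^{\mathbb N}: x_n\to 0\}$, both endowed with the subspace topology inherited from the product topology of $\mathbb R^{\mathbb N}$ (not with the norm topology). A quotient of a topological vector space $E$ is a space $E/Z$ with the quotient topology, where $Z$ is a closed linear subspace of $E$; isomorphic means linearly homeomorphic; a linear subspace $S$ of $E$ is complemented if there is a continuous linear projection of $E$ onto $S$. A locally convex space is Polishable if it admits a finer locally convex vector topology that is separable, metrizable and complete (a separable Fréchet topology). Then the space $C_p(\beta\mathbb N)$ 1. has a quotient isomorphic to $\ell_\infty$; 2. contains a linear subspace isomorphic to $c_0$; 3. has no quotient isomorphic to $c_0$; 4. has no infinite-dimensional Polishable quotient; 5. contains no complemented separable infinite-dimensional linear subspace. -/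

import Mathlib

open Filter Topology

/-- `C_p(X)`: the vector space of continuous real-valued functions on `X`. As a subspace of the
product `ℝ^X = (X → ℝ)` its type carries the topology of pointwise convergence. -/
abbrev Cp (X : Type*) [TopologicalSpace X] : Submodule ℝ (X → ℝ) :=
  continuousSubmodule X ℝ ℝ

/-- The space of bounded real sequences, as a subspace of `ℝ^ℕ` with the product topology
(not with the supremum norm). -/
def ellInfty : Submodule ℝ (ℕ → ℝ) where
  carrier := {x | ∃ C : ℝ, ∀ n, |x n| ≤ C}
  add_mem' := by
    rintro x y ⟨C, hC⟩ ⟨D, hD⟩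
    exact ⟨C + D, fun n => (abs_add_le _ _).trans (add_le_add (hC n) (hD n))⟩
  zero_mem' := ⟨0, fun n => by simp⟩
  smul_mem' := by
    rintro c x ⟨C, hC⟩
    refine ⟨|c| * C, fun n => ?_⟩
    simpa [abs_mul] using mul_le_mul_of_nonneg_left (hC n) (abs_nonneg c)

/-- The space of real sequences converging to zero, as a subspace of `ℝ^ℕ` with the product
topology (not with the supremum norm). -/
def cZero : Submodule ℝ (ℕ → ℝ) where
  carrier := {x | Tendsto x atTop (𝓝 0)}
  add_mem' {x y} hx hy := by
    have h : Tendsto (fun n => x n + y n) atTop (𝓝 (0 + 0)) := Tendsto.add hx hy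
    rwa [add_zero] at h
  zero_mem' := tendsto_const_nhds
  smul_mem' c x hx := by
    have h : Tendsto (fun n => c * x n) atTop (𝓝 (c * 0)) := Tendsto.const_mul c hx
    rwa [mul_zero] at h

/-- A real topological vector space `E` is *Polishable* if it admits a stronger (i.e. finer)
separable Fréchet topology: a locally convex vector space topology which is metrizable, complete
and separable. The uniform structure below is the one that the vector space topology induces
(this is `IsUniformAddGroup`), so `CompleteSpace` is completeness as a topological vector space.
Recall that `t₁ ≤ t₂` in Mathlib means that `t₁` is finer than `t₂`. -/
def IsPolishable (E : Type*) [AddCommGroup E] [Module ℝ E] [τ : TopologicalSpace E] : Prop :=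
  ∃ u : UniformSpace E,
    u.toTopologicalSpace ≤ τ ∧
    @IsUniformAddGroup E u _ ∧
    @ContinuousSMul ℝ E _ _ u.toTopologicalSpace ∧
    @LocallyConvexSpace ℝ E _ _ _ _ u.toTopologicalSpace ∧
    @TopologicalSpace.MetrizableSpace E u.toTopologicalSpace ∧
    @CompleteSpace E u ∧
    @TopologicalSpace.SeparableSpace E u.toTopologicalSpace

open Filter Topology

/-! The negative claims rest on one fact, `not_tendsto_pairing_zero`: finitely supported measures on
βℕ with disjoint supports and norm 1 cannot tend to 0 on every continuous function. A gliding hump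
gives a subsequence almost carried by disjoint clopen sets, and the function equal to the sign of
each measure on its own set extends to βℕ. If C_p(βℕ)/Z is infinite dimensional, so is the space of
measures annihilating Z. It then contains such a sequence whose n-th term also kills the first n
members of a given sequence `d`. Were `d` norm dense modulo Z, these measures would tend to 0
everywhere. Hence norm-separable quotients are finite dimensional
(`Cp.finiteDimensional_quotient_of_dense_seq`). Polishable quotients and c₀ reduce to this by the
closed graph theorem, complemented subspaces because pointwise separability implies norm
separability. For the positive claims, sequences in c₀ extend by 0 to βℕ \ ℕ, and weighted averages
over disjoint finite blocks of growing length map C_p(βℕ) openly onto ℓ_∞. -/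

/-! ### Points of βℕ as ultrafilters. -/

theorem exists_ultrafilter_tendsto_stoneCechUnit (x : StoneCech ℕ) :
    ∃ U : Ultrafilter ℕ, Tendsto stoneCechUnit (U : Filter ℕ) (𝓝 x) := by
  have hx : (comap (stoneCechUnit : ℕ → StoneCech ℕ) (𝓝 x)).NeBot :=
    comap_neBot_iff_frequently.2 (mem_closure_iff_frequently.1 (denseRange_stoneCechUnit x))
  exact ⟨Ultrafilter.of _, tendsto_iff_comap.2 (Ultrafilter.of_le _)⟩

/-- A chosen ultrafilter on `ℕ` converging to a given point of the Stone–Čech compactification. -/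
noncomputable def StoneCech.ultrafilter (x : StoneCech ℕ) : Ultrafilter ℕ :=
  (exists_ultrafilter_tendsto_stoneCechUnit x).choose

theorem StoneCech.tendsto_ultrafilter (x : StoneCech ℕ) :
    Tendsto stoneCechUnit (x.ultrafilter : Filter ℕ) (𝓝 x) :=
  (exists_ultrafilter_tendsto_stoneCechUnit x).choose_spec

theorem Cp.tendsto_ultrafilter (f : Cp (StoneCech ℕ)) (x : StoneCech ℕ) :
    Tendsto (fun n => f.1 (stoneCechUnit n)) (x.ultrafilter : Filter ℕ) (𝓝 (f.1 x)) :=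
  (Continuous.tendsto f.2 x).comp x.tendsto_ultrafilter

theorem Cp.apply_eq_of_mem_ultrafilter (f : Cp (StoneCech ℕ)) {x : StoneCech ℕ} {A : Set ℕ}
    (hA : A ∈ x.ultrafilter) {a : ℝ} (h : ∀ n ∈ A, f.1 (stoneCechUnit n) = a) : f.1 x = a := by
  refine tendsto_nhds_unique (Cp.tendsto_ultrafilter f x) ?_
  refine tendsto_const_nhds.congr' ?_
  filter_upwards [hA] with n hn using (h n hn).symm

theorem Cp.abs_apply_le_of_mem_ultrafilter (f : Cp (StoneCech ℕ)) {x : StoneCech ℕ} {A : Set ℕ}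
    (hA : A ∈ x.ultrafilter) {C : ℝ} (h : ∀ n ∈ A, |f.1 (stoneCechUnit n)| ≤ C) :
    |f.1 x| ≤ C := by
  refine le_of_tendsto (Cp.tendsto_ultrafilter f x).abs ?_
  filter_upwards [hA] with n hn using h n hn

theorem Cp.exists_extension {y : ℕ → ℝ} {C : ℝ} (h : ∀ n, |y n| ≤ C) :
    ∃ f : Cp (StoneCech ℕ), ∀ n, f.1 (stoneCechUnit n) = y n := by
  let g : ℕ → Set.Icc (-C) C := fun n => ⟨y n, abs_le.1 (h n)⟩
  have hg : Continuous g := continuous_of_discreteTopology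
  exact ⟨⟨fun x => (stoneCechExtend hg x).1,
    continuous_subtype_val.comp (continuous_stoneCechExtend hg)⟩,
    fun n => by simp [g]⟩

theorem StoneCech.exists_set_separating {s t : Finset (StoneCech ℕ)} (h : Disjoint s t) :
    ∃ P : Set ℕ, (∀ x ∈ s, P ∈ x.ultrafilter) ∧ ∀ x ∈ t, Pᶜ ∈ x.ultrafilter := by
  obtain ⟨U, V, hU, hV, hsU, htV, hUV⟩ := SeparatedNhds.of_finset_finset s t h
  refine ⟨stoneCechUnit ⁻¹' U, fun x hx => ?_, fun x hx => ?_⟩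
  · exact x.tendsto_ultrafilter (hU.mem_nhds (hsU hx))
  · filter_upwards [x.tendsto_ultrafilter (hV.mem_nhds (htV hx))] with n hn hnU
    exact Set.disjoint_left.1 hUV hnU hn

/-! ### Disjointly supported measures and the gliding hump. -/

open Classical in
/-- The total variation of a finitely supported measure `μ` on the closure of `V ⊆ ℕ` in `βℕ`. -/
noncomputable def massOn (μ : StoneCech ℕ →₀ ℝ) (V : Set ℕ) : ℝ :=
  ∑ x ∈ μ.support, if V ∈ x.ultrafilter then |μ x| else 0

theorem sum_massOn_le {ι : Type*} (μ : StoneCech ℕ →₀ ℝ) (T : Finset ι) (V : ι → Set ℕ)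
    (hV : (T : Set ι).PairwiseDisjoint V) :
    ∑ i ∈ T, massOn μ (V i) ≤ ∑ x ∈ μ.support, |μ x| := by
  classical
  unfold massOn
  rw [Finset.sum_comm]
  refine Finset.sum_le_sum fun x _ => ?_
  by_cases hx : ∃ i ∈ T, V i ∈ x.ultrafilter
  · obtain ⟨i, hi, hxi⟩ := hx
    rw [Finset.sum_eq_single_of_mem i hi, if_pos hxi]
    intro j hj hji
    refine if_neg fun hxj => ?_
    have := inter_mem hxi hxj
    rw [(hV hi hj hji.symm).inter_eq] at this
    exact Ultrafilter.empty_notMem this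
  · push Not at hx
    rw [Finset.sum_eq_zero fun i hi => if_neg (hx i hi)]
    positivity

/-- Take more than 1/ε exceptional indices and separate their supports by disjoint sets. Some single
`μ k` then has mass at least ε on each of them, exceeding its total mass 1. -/
theorem finite_setOf_not_eventually_massOn_lt {μ : ℕ → StoneCech ℕ →₀ ℝ}
    (hdisj : Pairwise fun m n => Disjoint (μ m).support (μ n).support)
    (hnorm : ∀ n, ∑ x ∈ (μ n).support, |μ n x| = 1) (𝒰 : Ultrafilter ℕ) {ε : ℝ} (hε : 0 < ε) :
    {n | ¬ ∃ V : Set ℕ, (∀ x ∈ (μ n).support, V ∈ x.ultrafilter) ∧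
      ∀ᶠ k in (𝒰 : Filter ℕ), massOn (μ k) V < ε}.Finite := by
  classical
  by_contra hinf
  obtain ⟨N, hN⟩ := exists_nat_gt (1 / ε)
  obtain ⟨T, hT, rfl⟩ := Set.Infinite.exists_subset_card_eq hinf N
  obtain ⟨U, hU, hUd⟩ := (T.biUnion fun n => (μ n).support).finite_toSet.t2_separation
  let V : ℕ → Set ℕ := fun n => ⋃ x ∈ (μ n).support, stoneCechUnit ⁻¹' U x
  have hVmem : ∀ n, ∀ x ∈ (μ n).support, V n ∈ x.ultrafilter := fun n x hx =>
    mem_of_superset (x.tendsto_ultrafilter ((hU x).2.mem_nhds (hU x).1))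
      (Set.subset_biUnion_of_mem (u := fun x => stoneCechUnit ⁻¹' U x) hx)
  have hVd : (T : Set ℕ).PairwiseDisjoint V := by
    intro m hm n hn hmn
    simp only [Function.onFun, V, Set.disjoint_iUnion_left, Set.disjoint_iUnion_right]
    intro x hx y hy
    refine Disjoint.preimage _ (hUd (Finset.mem_coe.2 (Finset.mem_biUnion.2 ⟨m, hm, hy⟩))
      (Finset.mem_coe.2 (Finset.mem_biUnion.2 ⟨n, hn, hx⟩)) ?_)
    rintro rfl
    exact Finset.disjoint_left.1 (hdisj hmn) hy hx
  have hev : ∀ᶠ k in (𝒰 : Filter ℕ), ∀ n ∈ T, ε ≤ massOn (μ k) (V n) := by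
    rw [Filter.eventually_all_finset]
    intro n hn
    have h1 : ¬ ∀ᶠ k in (𝒰 : Filter ℕ), massOn (μ k) (V n) < ε := fun h =>
      hT hn ⟨V n, hVmem n, h⟩
    rw [← Ultrafilter.eventually_not] at h1
    simpa using h1
  obtain ⟨k, hk⟩ := hev.exists
  have h1 := sum_massOn_le (μ k) T V hVd
  have h2 := Finset.card_nsmul_le_sum T _ ε hk
  rw [hnorm] at h1
  rw [nsmul_eq_mul] at h2
  rw [div_lt_iff₀ hε] at hN
  linarith

/-- Signed measures that are almost supported by successive disjoint clopen sets do not converge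
to zero at all continuous functions on `βℕ`. -/
theorem exists_one_half_le_pairing {μ : ℕ → StoneCech ℕ →₀ ℝ} {V : ℕ → Set ℕ}
    (hnorm : ∀ n, ∑ x ∈ (μ n).support, |μ n x| = 1)
    (hV : ∀ n, ∀ x ∈ (μ n).support, V n ∈ x.ultrafilter)
    (hmass : ∀ n, ∑ j ∈ Finset.range n, massOn (μ n) (V j) ≤ 1 / 4) :
    ∃ f : Cp (StoneCech ℕ), ∀ n, 1 / 2 ≤ ∑ x ∈ (μ n).support, μ n x * f.1 x := by
  classical
  have hP : ∀ n, ∃ P : Set ℕ, ∀ x ∈ (μ n).support,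
      (0 < μ n x → P ∈ x.ultrafilter) ∧ (μ n x < 0 → Pᶜ ∈ x.ultrafilter) := by
    intro n
    obtain ⟨P, h1, h2⟩ := StoneCech.exists_set_separating
      (s := (μ n).support.filter fun x => 0 < μ n x) (t := (μ n).support.filter fun x => μ n x < 0)
      (Finset.disjoint_filter.2 fun x _ h h' => lt_asymm h h')
    exact ⟨P, fun x hx => ⟨fun h => h1 x (Finset.mem_filter.2 ⟨hx, h⟩),
      fun h => h2 x (Finset.mem_filter.2 ⟨hx, h⟩)⟩⟩
  choose P hP using hP
  -- On `V n` minus the earlier `V j`, the value is the sign of `μ n`, encoded by `P n`.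
  let y : ℕ → ℝ := fun i =>
    if h : ∃ k, i ∈ V k then if i ∈ P (Nat.find h) then 1 else -1 else 0
  have hy : ∀ i, |y i| ≤ 1 := by
    intro i
    simp only [y]
    split_ifs <;> simp
  obtain ⟨f, hf⟩ := Cp.exists_extension hy
  refine ⟨f, fun n => ?_⟩
  -- A point caught by an earlier `V j` may contribute `-|μ n x|` instead of `|μ n x|`, hence the
  -- factor 2. Summing gives at least 1 - 2 · (1/4).
  have key : ∀ x ∈ (μ n).support, |μ n x| - 2 * ∑ j ∈ Finset.range n,
      (if V j ∈ x.ultrafilter then |μ n x| else 0) ≤ μ n x * f.1 x := by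
    intro x hx
    by_cases hbad : ∃ j ∈ Finset.range n, V j ∈ x.ultrafilter
    · obtain ⟨j, hj, hxj⟩ := hbad
      have h1 : |μ n x| ≤ ∑ j ∈ Finset.range n, (if V j ∈ x.ultrafilter then |μ n x| else 0) := by
        refine le_trans (le_of_eq (if_pos hxj).symm) (Finset.single_le_sum
          (f := fun j => if V j ∈ x.ultrafilter then |μ n x| else 0) (fun i _ => ?_) hj)
        split_ifs <;> positivity
      have h2 : |f.1 x| ≤ 1 := Cp.abs_apply_le_of_mem_ultrafilter f (A := Set.univ)
        Filter.univ_mem fun i _ => by rw [hf]; exact hy i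
      have h3 : |μ n x * f.1 x| ≤ |μ n x| := by
        rw [abs_mul]
        exact mul_le_of_le_one_right (abs_nonneg _) h2
      linarith [neg_abs_le (μ n x * f.1 x)]
    · push Not at hbad
      rw [Finset.sum_eq_zero fun j hj => if_neg (hbad j hj), mul_zero, sub_zero]
      have hA : (V n ∩ ⋂ j ∈ Finset.range n, (V j)ᶜ) ∈ x.ultrafilter :=
        inter_mem (hV n x hx) ((biInter_finset_mem _).2 fun j hj =>
          Ultrafilter.compl_mem_iff_notMem.2 (hbad j hj))
      have hyA : ∀ i ∈ (V n ∩ ⋂ j ∈ Finset.range n, (V j)ᶜ),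
          y i = if i ∈ P n then 1 else -1 := by
        rintro i ⟨hi, hi'⟩
        simp only [Set.mem_iInter, Finset.mem_range, Set.mem_compl_iff] at hi'
        have hex : ∃ k, i ∈ V k := ⟨n, hi⟩
        have hfind : Nat.find hex = n := (Nat.find_eq_iff hex).2 ⟨hi, fun j hj => hi' j hj⟩
        simp only [y, dif_pos hex, hfind]
      rcases lt_or_gt_of_ne (Finsupp.mem_support_iff.1 hx) with hneg | hpos
      · rw [Cp.apply_eq_of_mem_ultrafilter f (a := -1) (inter_mem hA ((hP n x hx).2 hneg)),
          abs_of_neg hneg]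
        · linarith
        · rintro i ⟨hi, hi'⟩
          rw [hf, hyA i hi, if_neg hi']
      · rw [Cp.apply_eq_of_mem_ultrafilter f (a := 1) (inter_mem hA ((hP n x hx).1 hpos)),
          abs_of_pos hpos]
        · linarith
        · rintro i ⟨hi, hi'⟩
          rw [hf, hyA i hi, if_pos hi']
  have hsum := Finset.sum_le_sum key
  rw [Finset.sum_sub_distrib, ← Finset.mul_sum, Finset.sum_comm, hnorm] at hsum
  have := hmass n
  unfold massOn at this
  linarith

/-- `C_p(βℕ)` fails the Josefson–Nissenzweig property for disjointly supported measures. -/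
theorem not_tendsto_pairing_zero {μ : ℕ → StoneCech ℕ →₀ ℝ}
    (hdisj : Pairwise fun m n => Disjoint (μ m).support (μ n).support)
    (hnorm : ∀ n, ∑ x ∈ (μ n).support, |μ n x| = 1) :
    ¬ ∀ f : Cp (StoneCech ℕ),
      Tendsto (fun n => ∑ x ∈ (μ n).support, μ n x * f.1 x) atTop (𝓝 0) := by
  classical
  intro hlim
  let 𝒰 : Ultrafilter ℕ := Ultrafilter.of atTop
  have h𝒰 : (𝒰 : Filter ℕ) ≤ atTop := Ultrafilter.of_le _
  let ε : ℕ → ℝ := fun l => (1 / 8) * (1 / 2) ^ l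
  have hε : ∀ l, 0 < ε l := fun l => by positivity
  -- A triple holds a tolerance level, the index of a measure and a set around its support. Levels
  -- strictly increase, so the j-th tolerance is at most `ε j`, and these sum to at most 1/4.
  obtain ⟨F, hFP, hFr⟩ := exists_seq_of_forall_finset_exists
    (P := fun q : ℕ × ℕ × Set ℕ => (∀ x ∈ (μ q.2.1).support, q.2.2 ∈ x.ultrafilter) ∧
      ∀ᶠ k in (𝒰 : Filter ℕ), massOn (μ k) q.2.2 < ε q.1)
    (r := fun q q' : ℕ × ℕ × Set ℕ => q.1 < q'.1 ∧ q.2.1 < q'.2.1 ∧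
      massOn (μ q'.2.1) q.2.2 < ε q.1) (by
    intro s hs
    let l := s.sup (fun q => q.1) + 1
    have h1 : ∀ᶠ n in (𝒰 : Filter ℕ), ∃ V : Set ℕ, (∀ x ∈ (μ n).support, V ∈ x.ultrafilter) ∧
        ∀ᶠ k in (𝒰 : Filter ℕ), massOn (μ k) V < ε l := by
      refine h𝒰 ?_
      rw [← Nat.cofinite_eq_atTop]
      exact finite_setOf_not_eventually_massOn_lt hdisj hnorm 𝒰 (hε l)
    have h2 : ∀ᶠ n in (𝒰 : Filter ℕ), s.sup (fun q => q.2.1) < n := h𝒰 (eventually_gt_atTop _)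
    have h3 : ∀ᶠ n in (𝒰 : Filter ℕ), ∀ q ∈ s, massOn (μ n) q.2.2 < ε q.1 := by
      rw [Filter.eventually_all_finset]
      exact fun q hq => (hs q hq).2
    obtain ⟨n, ⟨V, hV, hVm⟩, hn, hm⟩ := (h1.and (h2.and h3)).exists
    exact ⟨⟨l, n, V⟩, ⟨hV, hVm⟩, fun q hq =>
      ⟨Nat.lt_succ_of_le (Finset.le_sup (f := fun q : ℕ × ℕ × Set ℕ => q.1) hq),
        (Finset.le_sup (f := fun q : ℕ × ℕ × Set ℕ => q.2.1) hq).trans_lt hn, hm q hq⟩⟩)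
  have hl : StrictMono fun k => (F k).1 := fun i j hij => (hFr i j hij).1
  have hn : StrictMono fun k => (F k).2.1 := fun i j hij => (hFr i j hij).2.1
  obtain ⟨f, hf⟩ := exists_one_half_le_pairing (μ := fun k => μ (F k).2.1)
    (V := fun k => (F k).2.2) (fun k => hnorm _) (fun k => (hFP k).1) (by
    intro k
    calc ∑ j ∈ Finset.range k, massOn (μ (F k).2.1) (F j).2.2
        ≤ ∑ j ∈ Finset.range k, ε j := by
          refine Finset.sum_le_sum fun j hj => ((hFr j k (Finset.mem_range.1 hj)).2.2.le).trans ?_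
          exact mul_le_mul_of_nonneg_left
            (pow_le_pow_of_le_one (by norm_num) (by norm_num) (hl.le_apply)) (by norm_num)
      _ = (1 / 8) * ∑ j ∈ Finset.range k, (1 / 2 : ℝ) ^ j := by rw [Finset.mul_sum]
      _ ≤ (1 / 8) * 2 := by
          gcongr
          exact sum_geometric_two_le k
      _ = 1 / 4 := by norm_num)
  have := ge_of_tendsto' ((hlim f).comp hn.tendsto_atTop) hf
  norm_num at this

/-! ### A closed graph theorem on Baire spaces. -/

section ClosedGraph

variable {F Q : Type*} [AddCommGroup F] [Module ℝ F] [TopologicalSpace F] [IsTopologicalAddGroup F]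
  [ContinuousSMul ℝ F] [BaireSpace F] [NormedAddCommGroup Q] [NormedSpace ℝ Q]

/-- Dilates of the closed set for radius r/2 cover `F`, so by Baire one has interior. Differences of
points of that set lie in the set for radius r. -/
theorem LinearMap.closure_preimage_ball_mem_nhds (T : F →ₗ[ℝ] Q) {r : ℝ} (hr : 0 < r) :
    closure (T ⁻¹' Metric.ball 0 r) ∈ 𝓝 (0 : F) := by
  set A : Set F := closure (T ⁻¹' Metric.ball 0 (r / 2)) with hA
  obtain ⟨n, hn⟩ : ∃ n : ℕ, (interior ((fun u : F => ((n : ℝ) + 1)⁻¹ • u) ⁻¹' A)).Nonempty := by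
    refine nonempty_interior_of_iUnion_of_closed (fun n => isClosed_closure.preimage
      (continuous_const_smul _)) (Set.eq_univ_of_forall fun u => Set.mem_iUnion.2 ?_)
    obtain ⟨n, hn⟩ := exists_nat_gt (‖T u‖ / (r / 2))
    refine ⟨n, subset_closure ?_⟩
    have hn0 : (0 : ℝ) < (n : ℝ) + 1 := by positivity
    rw [div_lt_iff₀ (by positivity)] at hn
    rw [Set.mem_preimage, mem_ball_zero_iff, map_smul, norm_smul, norm_inv,
      Real.norm_of_nonneg hn0.le, inv_mul_lt_iff₀ hn0]
    nlinarith
  have hn0 : ((n : ℝ) + 1) ≠ 0 := by positivity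
  obtain ⟨u, hu⟩ := hn
  have hcont : Continuous fun v : F => u + ((n : ℝ) + 1) • v := by fun_prop
  have hmem : ∀ᶠ v in 𝓝 (0 : F), ((n : ℝ) + 1)⁻¹ • u + v ∈ A := by
    have : (fun v : F => u + ((n : ℝ) + 1) • v) ⁻¹'
        (interior ((fun u : F => ((n : ℝ) + 1)⁻¹ • u) ⁻¹' A)) ∈ 𝓝 (0 : F) :=
      hcont.continuousAt.preimage_mem_nhds (isOpen_interior.mem_nhds (by simpa using hu))
    filter_upwards [this] with v hv
    have := interior_subset hv
    rwa [Set.mem_preimage, smul_add, inv_smul_smul₀ hn0] at this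
  have hu' : ((n : ℝ) + 1)⁻¹ • u ∈ A := by
    simpa using hmem.self_of_nhds
  filter_upwards [hmem] with v hv
  have hsub : ((n : ℝ) + 1)⁻¹ • u + v - ((n : ℝ) + 1)⁻¹ • u ∈
      closure (T ⁻¹' Metric.ball 0 r) := by
    refine map_mem_closure₂ continuous_sub hv hu' fun a ha b hb => ?_
    rw [Set.mem_preimage, mem_ball_zero_iff] at *
    rw [map_sub]
    linarith [norm_sub_le (T a) (T b)]
  simpa using hsub

/-- The closed graph theorem for maps from a first countable Baire topological vector space
to a Banach space. -/
theorem LinearMap.continuous_of_seq_closed_graph_of_baireSpace [FirstCountableTopology F]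
    [CompleteSpace Q] (T : F →ₗ[ℝ] Q)
    (hT : ∀ (u : ℕ → F) (x : F) (y : Q), Tendsto u atTop (𝓝 x) →
      Tendsto (fun n => T (u n)) atTop (𝓝 y) → y = T x) :
    Continuous T := by
  -- Successive approximation: correct `x` to a sequence tending to 0 whose images move by at most
  -- r/2^n at step n. The images converge, to 0 by the closed graph, so `T x` has norm at most 2r.
  have hbound : ∀ r : ℝ, 0 < r → ∀ x ∈ closure (T ⁻¹' Metric.ball 0 r), ‖T x‖ ≤ 2 * r := by
    intro r hr x hx
    obtain ⟨U, hU⟩ := (𝓝 (0 : F)).exists_antitone_basis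
    let V : ℕ → Set F := fun n => closure (T ⁻¹' Metric.ball 0 (r / 2 ^ n))
    have hV : ∀ n, V n ∈ 𝓝 (0 : F) := fun n => T.closure_preimage_ball_mem_nhds (by positivity)
    have hstep : ∀ n, ∀ x ∈ V n, ∃ x', x' ∈ V (n + 1) ∧ x' ∈ U n ∧
        ‖T x - T x'‖ ≤ r / 2 ^ n := by
      intro n x hx
      have hnhds : (fun a => x - a) ⁻¹' (V (n + 1) ∩ U n) ∈ 𝓝 x := by
        refine (continuous_const.sub continuous_id).continuousAt.preimage_mem_nhds ?_
        simpa using inter_mem (hV (n + 1)) (hU.1.mem_of_mem trivial)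
      obtain ⟨a, ⟨ha1, ha2⟩, ha⟩ := mem_closure_iff_nhds.1 hx _ hnhds
      refine ⟨x - a, ha1, ha2, ?_⟩
      rw [Set.mem_preimage, mem_ball_zero_iff] at ha
      rw [← map_sub, sub_sub_cancel]
      exact ha.le
    choose! next h1 h2 h3 using hstep
    let s : ℕ → F := fun n => Nat.rec x (fun n y => next n y) n
    have hs : ∀ n, s n ∈ V n := by
      intro n
      induction n with
      | zero => simpa [s, V] using hx
      | succ n ih => exact h1 n _ ih
    have hs0 : Tendsto s atTop (𝓝 0) :=
      (tendsto_add_atTop_iff_nat 1).1 (hU.tendsto fun n => h2 n _ (hs n))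
    have hdist : ∀ n, dist (T (s n)) (T (s (n + 1))) ≤ (2 * r) / 2 / 2 ^ n := by
      intro n
      rw [dist_eq_norm, mul_div_cancel_left₀ _ two_ne_zero]
      exact h3 n _ (hs n)
    obtain ⟨y, hy⟩ := cauchySeq_tendsto_of_complete (cauchySeq_of_le_geometric_two hdist)
    have hy0 : y = 0 := by rw [hT s 0 y hs0 hy, map_zero]
    have := dist_le_of_le_geometric_two_of_tendsto₀ hdist hy
    simpa [hy0, s] using this
  refine continuous_of_continuousAt_zero T ?_
  rw [ContinuousAt, map_zero, Metric.tendsto_nhds]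
  intro ε hε
  filter_upwards [T.closure_preimage_ball_mem_nhds (r := ε / 4) (by positivity)] with x hx
  rw [dist_zero_right]
  linarith [hbound (ε / 4) (by positivity) x hx]

end ClosedGraph

/-! ### Annihilating measures. -/

section Annihilator

variable {X : Type*} [TopologicalSpace X]

/-- The pairing of continuous functions with finitely supported measures. -/
noncomputable def Cp.pairing : Cp X →ₗ[ℝ] (X →₀ ℝ) →ₗ[ℝ] ℝ where
  toFun f := Finsupp.linearCombination ℝ f.1
  map_add' f g := by
    ext
    simp
  map_smul' c f := by
    ext
    simp

theorem Cp.pairing_apply (f : Cp X) (μ : X →₀ ℝ) :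
    Cp.pairing f μ = ∑ x ∈ μ.support, μ x * f.1 x := rfl

/-- The finitely supported measures vanishing on a subspace of `C_p(X)`. -/
def Cp.annihilator (Z : Submodule ℝ (Cp X)) : Submodule ℝ (X →₀ ℝ) where
  carrier := {μ | ∀ z ∈ Z, Cp.pairing z μ = 0}
  add_mem' hμ hν z hz := by rw [map_add, hμ z hz, hν z hz, add_zero]
  zero_mem' z _ := map_zero _
  smul_mem' c μ hμ z hz := by rw [map_smul, hμ z hz, smul_zero]

/-- A basic neighbourhood of `f` missing `Z` involves finitely many points. Separation therefore
takes place in a finite-dimensional ℝ^I, whose functionals are measures supported on I. -/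
theorem Cp.exists_mem_annihilator_pairing_ne_zero {Z : Submodule ℝ (Cp X)}
    (hZ : IsClosed (Z : Set (Cp X))) {f : Cp X} (hf : f ∉ Z) :
    ∃ μ ∈ Cp.annihilator Z, Cp.pairing f μ ≠ 0 := by
  classical
  have h1 : (Z : Set (Cp X))ᶜ ∈ 𝓝 f := hZ.isOpen_compl.mem_nhds hf
  rw [nhds_subtype_eq_comap, nhds_pi, mem_comap] at h1
  obtain ⟨t, ht, hts⟩ := h1
  obtain ⟨I, hI, s, hs, hst⟩ := Filter.mem_pi.1 ht
  have : Fintype I := hI.fintype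
  let r : Cp X →ₗ[ℝ] (I → ℝ) := LinearMap.pi fun i => LinearMap.proj i.1 ∘ₗ (Cp X).subtype
  have hr : r f ∉ Z.map r := by
    rintro ⟨z, hz, hzf⟩
    refine hts (show z.1 ∈ t from hst fun i hi => ?_) hz
    rw [show z.1 i = f.1 i from congrFun hzf ⟨i, hi⟩]
    exact mem_of_mem_nhds (hs i)
  obtain ⟨φ, hφf, hφ⟩ := Submodule.exists_le_ker_of_notMem hr
  have hpair : ∀ g : Cp X, Cp.pairing g
      (∑ i : I, Finsupp.single i.1 (φ (Pi.single i 1))) = φ (r g) := by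
    intro g
    rw [map_sum, LinearMap.pi_apply_eq_sum_univ φ (r g)]
    refine Finset.sum_congr rfl fun i _ => ?_
    have : (fun j => if i = j then (1 : ℝ) else 0) = Pi.single i 1 := by
      ext j
      simp [Pi.single_apply, eq_comm]
    rw [this, smul_eq_mul, mul_comm]
    simp [Cp.pairing, r]
  refine ⟨∑ i : I, Finsupp.single i.1 (φ (Pi.single i 1)), fun z hz => ?_, ?_⟩
  · rw [hpair]
    exact hφ (Submodule.mem_map_of_mem hz)
  · rw [hpair]
    exact hφf

theorem Submodule.finiteDimensional_quotient_of_polar {E V : Type*} [AddCommGroup E] [Module ℝ E]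
    [AddCommGroup V] [Module ℝ V] (B : E →ₗ[ℝ] V →ₗ[ℝ] ℝ) {W : Submodule ℝ V} {Z : Submodule ℝ E}
    (hW : FiniteDimensional ℝ W) (h : ∀ f, f ∈ Z ↔ ∀ w ∈ W, B f w = 0) :
    FiniteDimensional ℝ (E ⧸ Z) := by
  let L : E →ₗ[ℝ] W →ₗ[ℝ] ℝ := LinearMap.lcomp ℝ ℝ W.subtype ∘ₗ B
  have hL : LinearMap.ker L = Z := by
    ext f
    rw [h, LinearMap.mem_ker]
    exact ⟨fun hf w hw => LinearMap.congr_fun hf ⟨w, hw⟩,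
      fun hf => LinearMap.ext fun w => hf w w.2⟩
  rw [← hL]
  exact Module.Finite.of_injective _ L.quotKerEquivRange.injective

theorem Cp.not_finiteDimensional_annihilator {Z : Submodule ℝ (Cp X)}
    (hZ : IsClosed (Z : Set (Cp X))) (hdim : ¬ FiniteDimensional ℝ (Cp X ⧸ Z)) :
    ¬ FiniteDimensional ℝ (Cp.annihilator Z) := by
  refine fun hfin => hdim (Submodule.finiteDimensional_quotient_of_polar Cp.pairing hfin
    fun f => ⟨fun hf μ hμ => hμ f hf, fun h => ?_⟩)
  by_contra hfZ
  obtain ⟨μ, hμ, hne⟩ := Cp.exists_mem_annihilator_pairing_ne_zero hZ hfZ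
  exact hne (h μ hμ)

end Annihilator

theorem Submodule.exists_ne_zero_forall_eq_zero {V : Type*} [AddCommGroup V] [Module ℝ V]
    {W : Submodule ℝ V} (hW : ¬ FiniteDimensional ℝ W) {ι : Type*} [Finite ι]
    (φ : ι → V →ₗ[ℝ] ℝ) : ∃ w ∈ W, w ≠ 0 ∧ ∀ i, φ i w = 0 := by
  by_contra! h
  have := Fintype.ofFinite ι
  refine hW (Module.Finite.of_injective (LinearMap.pi φ ∘ₗ W.subtype) ?_)
  rw [← LinearMap.ker_eq_bot, LinearMap.ker_eq_bot']
  rintro ⟨w, hw⟩ hw0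
  by_contra hne
  obtain ⟨i, hi⟩ := h w hw fun h0 => hne (Subtype.ext h0)
  exact hi (congrFun hw0 i)

theorem Cp.exists_normalized_disjoint_seq {X : Type*} [TopologicalSpace X]
    {W : Submodule ℝ (X →₀ ℝ)} (hW : ¬ FiniteDimensional ℝ W) (d : ℕ → Cp X) :
    ∃ μ : ℕ → X →₀ ℝ, (∀ n, μ n ∈ W) ∧
      (Pairwise fun m n => Disjoint (μ m).support (μ n).support) ∧
      (∀ n, ∑ x ∈ (μ n).support, |μ n x| = 1) ∧ ∀ n, ∀ k < n, Cp.pairing (d k) (μ n) = 0 := by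
  classical
  obtain ⟨F, hFP, hFr⟩ := exists_seq_of_forall_finset_exists
    (P := fun q : ℕ × (X →₀ ℝ) => q.2 ∈ W ∧ ∑ x ∈ q.2.support, |q.2 x| = 1 ∧
      ∀ k < q.1, Cp.pairing (d k) q.2 = 0)
    (r := fun q q' => q.1 < q'.1 ∧ Disjoint q.2.support q'.2.support) (by
    intro s _
    let l := s.sup (fun q => q.1) + 1
    -- Finitely many linear conditions: kill `d k` for k < l, and vanish at every point of the
    -- earlier supports.
    obtain ⟨w, hwW, hw0, hw⟩ := Submodule.exists_ne_zero_forall_eq_zero hW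
      (ι := Fin l ⊕ (s.biUnion fun q => q.2.support : Finset X))
      (Sum.elim (fun k => Cp.pairing (d k)) fun x => Finsupp.lapply x.1)
    have hpos : 0 < ∑ x ∈ w.support, |w x| :=
      Finset.sum_pos (fun x hx => abs_pos.2 (Finsupp.mem_support_iff.1 hx))
        (Finsupp.support_nonempty_iff.2 hw0)
    set c := ∑ x ∈ w.support, |w x| with hc
    have hsupp : (c⁻¹ • w).support = w.support :=
      Finsupp.support_smul_eq (inv_ne_zero hpos.ne')
    refine ⟨(l, c⁻¹ • w), ⟨W.smul_mem _ hwW, ?_, fun k hk => ?_⟩, fun q hq =>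
      ⟨Nat.lt_succ_of_le (Finset.le_sup (f := fun q : ℕ × (X →₀ ℝ) => q.1) hq), ?_⟩⟩
    · rw [hsupp]
      simp only [Finsupp.smul_apply, smul_eq_mul, abs_mul]
      rw [← Finset.mul_sum, ← hc, abs_of_pos (inv_pos.2 hpos), inv_mul_cancel₀ hpos.ne']
    · rw [map_smul, show Cp.pairing (d k) w = 0 from hw (Sum.inl ⟨k, hk⟩), smul_zero]
    · rw [hsupp, Finset.disjoint_left]
      intro x hx hxw
      exact Finsupp.mem_support_iff.1 hxw
        (hw (Sum.inr ⟨x, Finset.mem_biUnion.2 ⟨q, hq, hx⟩⟩)))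
  have hl : StrictMono fun k => (F k).1 := fun i j hij => (hFr i j hij).1
  refine ⟨fun n => (F n).2, fun n => (hFP n).1, fun m n hmn => ?_, fun n => (hFP n).2.1,
    fun n k hk => (hFP n).2.2 k (hk.trans_le (hl.le_apply (x := n)))⟩
  rcases lt_or_gt_of_ne hmn with h | h
  · exact (hFr m n h).2
  · exact (hFr n m h).2.symm

theorem Cp.abs_pairing_le {X : Type*} [TopologicalSpace X] {f : Cp X} {ε : ℝ}
    (hf : ∀ x, |f.1 x| ≤ ε) {μ : X →₀ ℝ} (hμ : ∑ x ∈ μ.support, |μ x| = 1) :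
    |Cp.pairing f μ| ≤ ε := by
  rw [Cp.pairing_apply]
  calc |∑ x ∈ μ.support, μ x * f.1 x| ≤ ∑ x ∈ μ.support, |μ x| * ε := by
        refine (Finset.abs_sum_le_sum_abs _ _).trans (Finset.sum_le_sum fun x _ => ?_)
        rw [abs_mul]
        exact mul_le_mul_of_nonneg_left (hf x) (abs_nonneg _)
    _ = ε := by rw [← Finset.sum_mul, hμ, one_mul]

/-! ### Separable and Polishable quotients. -/

/-- A quotient of `C_p(βℕ)` by a closed subspace that is separable for the quotient of the
supremum norm is finite dimensional. -/
theorem Cp.finiteDimensional_quotient_of_dense_seq {Z : Submodule ℝ (Cp (StoneCech ℕ))}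
    (hZ : IsClosed (Z : Set (Cp (StoneCech ℕ)))) (d : ℕ → Cp (StoneCech ℕ))
    (hd : ∀ f : Cp (StoneCech ℕ), ∀ ε : ℝ, 0 < ε →
      ∃ k, ∃ z ∈ Z, ∀ x, |(f - d k - z).1 x| ≤ ε) :
    FiniteDimensional ℝ (Cp (StoneCech ℕ) ⧸ Z) := by
  by_contra hdim
  obtain ⟨μ, hμW, hdisj, hnorm, hμd⟩ :=
    Cp.exists_normalized_disjoint_seq (Cp.not_finiteDimensional_annihilator hZ hdim) d
  refine not_tendsto_pairing_zero hdisj hnorm fun f => ?_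
  rw [Metric.tendsto_atTop]
  intro ε hε
  obtain ⟨k, z, hz, hk⟩ := hd f (ε / 2) (by positivity)
  refine ⟨k + 1, fun n hn => ?_⟩
  have h := Cp.abs_pairing_le hk (hnorm n)
  rw [map_sub, map_sub, LinearMap.sub_apply, LinearMap.sub_apply, hμd n k hn, hμW n z hz,
    sub_zero, sub_zero, Cp.pairing_apply] at h
  rw [Real.dist_eq, sub_zero]
  linarith

/-- A separable, first countable, Baire topological vector space does not map continuously and
linearly onto an infinite-dimensional quotient of `C_p(βℕ)`. -/
theorem Cp.finiteDimensional_quotient_of_surjective {F : Type*} [AddCommGroup F] [Module ℝ F]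
    [TopologicalSpace F] [IsTopologicalAddGroup F] [ContinuousSMul ℝ F] [BaireSpace F]
    [FirstCountableTopology F] [TopologicalSpace.SeparableSpace F]
    {Z : Submodule ℝ (Cp (StoneCech ℕ))} (hZ : IsClosed (Z : Set (Cp (StoneCech ℕ))))
    (S : F →ₗ[ℝ] Cp (StoneCech ℕ) ⧸ Z) (hS : Continuous S) (hsurj : Function.Surjective S) :
    FiniteDimensional ℝ (Cp (StoneCech ℕ) ⧸ Z) := by
  let ι : C(StoneCech ℕ, ℝ) ≃ₗ[ℝ] Cp (StoneCech ℕ) :=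
    { toFun := fun f => ⟨f, f.continuous⟩
      invFun := fun f => ⟨f.1, f.2⟩
      map_add' := fun _ _ => rfl
      map_smul' := fun _ _ => rfl
      left_inv := fun _ => rfl
      right_inv := fun _ => rfl }
  have hι : Continuous ι :=
    (continuous_pi fun x => continuous_eval_const x).subtype_mk _
  let N : Submodule ℝ C(StoneCech ℕ, ℝ) := Z.comap ι.toLinearMap
  have hN : IsClosed (N : Set C(StoneCech ℕ, ℝ)) := hZ.preimage hι
  let e : (C(StoneCech ℕ, ℝ) ⧸ N) ≃ₗ[ℝ] Cp (StoneCech ℕ) ⧸ Z :=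
    Submodule.Quotient.equiv N Z ι (by
      rw [Submodule.map_comap_eq_of_surjective ι.surjective])
  have he : Continuous e := by
    refine (Submodule.isOpenQuotientMap_mkQ N).isQuotientMap.continuous_iff.2 ?_
    exact (continuous_quot_mk (X := Cp (StoneCech ℕ))).comp hι
  let T : F →ₗ[ℝ] C(StoneCech ℕ, ℝ) ⧸ N := e.symm.toLinearMap ∘ₗ S
  have heT : ∀ u, e (T u) = S u := fun u => e.apply_symm_apply _
  -- The norm quotient maps continuously and injectively to the Hausdorff pointwise quotient, where
  -- `S` is continuous; this closes the graph of `T`.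
  have hT : Continuous T := by
    refine LinearMap.continuous_of_seq_closed_graph_of_baireSpace
      (Q := C(StoneCech ℕ, ℝ) ⧸ N) T fun u x y hu hy => ?_
    refine e.injective ?_
    rw [heT]
    refine tendsto_nhds_unique ((he.tendsto y).comp hy) ?_
    simpa only [Function.comp_def, heT] using (hS.tendsto x).comp hu
  have hTdense : DenseRange (T ∘ TopologicalSpace.denseSeq F) :=
    (e.symm.surjective.comp hsurj).denseRange.comp (TopologicalSpace.denseRange_denseSeq F) hT
  choose b hb using fun n => N.mkQ_surjective (T (TopologicalSpace.denseSeq F n))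
  refine Cp.finiteDimensional_quotient_of_dense_seq hZ (fun n => ι (b n)) fun f ε hε => ?_
  obtain ⟨n, hn⟩ := hTdense.exists_dist_lt (N.mkQ (ι.symm f)) hε
  rw [Function.comp_apply, ← hb, dist_eq_norm, ← map_sub] at hn
  obtain ⟨m, hm, hmn⟩ := Submodule.Quotient.norm_mk_lt (S := N) (N.mkQ (ι.symm f - b n))
    (sub_pos.2 hn)
  rw [add_sub_cancel] at hmn
  refine ⟨n, ι (ι.symm f - b n - m), (Submodule.Quotient.eq N).1 hm.symm, fun x => ?_⟩
  have : (f - ι (b n) - ι (ι.symm f - b n - m)) = ι m := by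
    rw [map_sub, map_sub, ι.apply_symm_apply]
    abel
  rw [this]
  exact (m.norm_coe_le_norm x).trans hmn.le

theorem Cp.finiteDimensional_quotient_of_isPolishable {Z : Submodule ℝ (Cp (StoneCech ℕ))}
    (hZ : IsClosed (Z : Set (Cp (StoneCech ℕ))))
    (h : IsPolishable (Cp (StoneCech ℕ) ⧸ Z)) : FiniteDimensional ℝ (Cp (StoneCech ℕ) ⧸ Z) := by
  obtain ⟨u, hle, hadd, hsmul, -, hmetr, hcompl, hsep⟩ := h
  have hcount : @Filter.IsCountablyGenerated _ (@uniformity _ u) := by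
    let := u
    exact IsUniformAddGroup.uniformity_countably_generated
  refine @Cp.finiteDimensional_quotient_of_surjective (Cp (StoneCech ℕ) ⧸ Z) _ _
    u.toTopologicalSpace ?_ hsmul ?_ ?_ hsep Z hZ
    LinearMap.id (continuous_id_of_le hle) Function.surjective_id
  · let := u
    infer_instance
  · let := u
    infer_instance
  · let := u
    infer_instance

/-! ### The Banach space c₀ over its pointwise version. -/

section CZero

open ZeroAtInfty

/-- The indicator of `{n}` as an element of the Banach space of null sequences. -/
noncomputable def ZeroAtInftyContinuousMap.natSingle (n : ℕ) : C₀(ℕ, ℝ) where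
  toFun := Pi.single n 1
  continuous_toFun := continuous_of_discreteTopology
  zero_at_infty' := by
    rw [cocompact_eq_atTop]
    refine tendsto_const_nhds.congr' ?_
    filter_upwards [eventually_gt_atTop n] with k hk
    rw [Pi.single_eq_of_ne hk.ne']

instance ZeroAtInftyContinuousMap.separableSpace_nat :
    TopologicalSpace.SeparableSpace C₀(ℕ, ℝ) := by
  have h := ((Set.countable_range
    ZeroAtInftyContinuousMap.natSingle).isSeparable.span (R := ℝ)).closure
  rw [← TopologicalSpace.isSeparable_univ_iff]
  refine h.mono fun f _ => Metric.mem_closure_iff.2 fun ε hε => ?_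
  have hf : Tendsto f atTop (𝓝 0) := cocompact_eq_atTop (α := ℕ) ▸ f.zero_at_infty'
  obtain ⟨N, hN⟩ := Metric.tendsto_atTop.1 hf (ε / 2) (by positivity)
  refine ⟨∑ n ∈ Finset.range N, f n • ZeroAtInftyContinuousMap.natSingle n,
    Submodule.sum_mem _ fun n _ => Submodule.smul_mem _ _ (Submodule.subset_span ⟨n, rfl⟩), ?_⟩
  refine lt_of_le_of_lt ?_ (half_lt_self hε)
  rw [← ZeroAtInftyContinuousMap.dist_toBCF_eq_dist,
    BoundedContinuousFunction.dist_le (by positivity)]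
  intro k
  have hsum : (∑ n ∈ Finset.range N, f n • ZeroAtInftyContinuousMap.natSingle n) k =
      if k < N then f k else 0 := by
    have : ∀ s : Finset ℕ, (∑ n ∈ s, f n • ZeroAtInftyContinuousMap.natSingle n) k =
        if k ∈ s then f k else 0 := by
      intro s
      induction s using Finset.induction_on with
      | empty => simp
      | insert a s ha ih =>
        rw [Finset.sum_insert ha, ZeroAtInftyContinuousMap.add_apply, ih,
          ZeroAtInftyContinuousMap.smul_apply]
        change f a • (Pi.single a 1 : ℕ → ℝ) k + _ = _
        by_cases hk : k = a
        · subst hk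
          simp [ha]
        · simp [hk]
    simpa using this (Finset.range N)
  change dist (f k) ((∑ n ∈ Finset.range N, f n • ZeroAtInftyContinuousMap.natSingle n) k) ≤ _
  rw [hsum]
  split_ifs with hk
  · rw [dist_self]
    positivity
  · exact (hN k (not_lt.1 hk)).le

/-- The identity from the Banach space of null sequences to the space of null sequences with the
topology of pointwise convergence. -/
def ZeroAtInftyContinuousMap.toCZero : C₀(ℕ, ℝ) →ₗ[ℝ] cZero where
  toFun f := ⟨f, show Tendsto f atTop (𝓝 0) from cocompact_eq_atTop (α := ℕ) ▸ f.zero_at_infty'⟩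
  map_add' _ _ := rfl
  map_smul' _ _ := rfl

theorem ZeroAtInftyContinuousMap.continuous_toCZero :
    Continuous ZeroAtInftyContinuousMap.toCZero := by
  refine (continuous_pi fun n => ?_).subtype_mk _
  exact (continuous_eval_const (F := BoundedContinuousFunction ℕ ℝ) n).comp
    ZeroAtInftyContinuousMap.isometry_toBCF.continuous

theorem ZeroAtInftyContinuousMap.toCZero_surjective :
    Function.Surjective ZeroAtInftyContinuousMap.toCZero := fun y =>
  ⟨⟨⟨y.1, continuous_of_discreteTopology⟩, (cocompact_eq_atTop (α := ℕ)).symm ▸ y.2⟩, rfl⟩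

theorem not_finiteDimensional_cZero : ¬ FiniteDimensional ℝ cZero := by
  intro h
  let v : ℕ → cZero := fun n =>
    ZeroAtInftyContinuousMap.toCZero (ZeroAtInftyContinuousMap.natSingle n)
  have hv : LinearIndependent ℝ v :=
    LinearIndependent.of_comp cZero.subtype (Pi.linearIndependent_single_one ℕ ℝ)
  have := hv.finite_of_isNoetherian
  exact not_finite ℕ

end CZero

theorem Cp.not_nonempty_quotient_equiv_cZero {Z : Submodule ℝ (Cp (StoneCech ℕ))}
    (hZ : IsClosed (Z : Set (Cp (StoneCech ℕ)))) :
    ¬ Nonempty ((Cp (StoneCech ℕ) ⧸ Z) ≃L[ℝ] cZero) := by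
  rintro ⟨e⟩
  have : FiniteDimensional ℝ (Cp (StoneCech ℕ) ⧸ Z) :=
    Cp.finiteDimensional_quotient_of_surjective hZ
      (e.symm.toLinearEquiv.toLinearMap ∘ₗ ZeroAtInftyContinuousMap.toCZero)
      (e.symm.continuous.comp ZeroAtInftyContinuousMap.continuous_toCZero)
      (e.symm.surjective.comp ZeroAtInftyContinuousMap.toCZero_surjective)
  exact not_finiteDimensional_cZero (Module.Finite.equiv e.toLinearEquiv)

/-! ### Separable and complemented subspaces. -/

/-- A pointwise separable subspace of `C(X)`, for `X` compact, is norm separable. -/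
theorem Cp.exists_dense_seq_of_separableSpace {X : Type*} [TopologicalSpace X] [CompactSpace X]
    (S : Submodule ℝ (Cp X)) [TopologicalSpace.SeparableSpace S] :
    ∃ d : ℕ → Cp X, ∀ f ∈ S, ∀ ε : ℝ, 0 < ε → ∃ k, ∀ x, |(f - d k).1 x| ≤ ε := by
  -- Members of `S` factor through the range of `Φ`, which is compact metrizable, so its continuous
  -- functions are norm separable.
  let Φ : X → ℕ → ℝ := fun x n => (TopologicalSpace.denseSeq S n).1.1 x
  have hΦ : Continuous Φ := continuous_pi fun n => (TopologicalSpace.denseSeq S n).1.2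
  have : CompactSpace (Set.range Φ) := isCompact_iff_compactSpace.1 (isCompact_range hΦ)
  let q : X → Set.range Φ := Set.rangeFactorization Φ
  have hqc : Continuous q := hΦ.subtype_mk _
  have hqs : Function.Surjective q := Set.rangeFactorization_surjective
  have hq : IsQuotientMap q := hqc.isClosedMap.isQuotientMap hqc hqs
  have hfactor : ∀ f ∈ S, ∀ x y, q x = q y → f.1 x = f.1 y := by
    intro f hf x y hxy
    have hcl : IsClosed {g : S | g.1.1 x = g.1.1 y} :=
      isClosed_eq ((continuous_apply x).comp
        (continuous_subtype_val.comp continuous_subtype_val))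
        ((continuous_apply y).comp (continuous_subtype_val.comp continuous_subtype_val))
    have hsub : Set.range (TopologicalSpace.denseSeq S) ⊆ {g : S | g.1.1 x = g.1.1 y} := by
      rintro _ ⟨n, rfl⟩
      exact congrFun (congrArg Subtype.val hxy) n
    exact hcl.closure_subset_iff.2 hsub (TopologicalSpace.denseRange_denseSeq S ⟨f, hf⟩)
  refine ⟨fun k => ⟨TopologicalSpace.denseSeq C(Set.range Φ, ℝ) k ∘ q,
    (ContinuousMap.continuous _).comp hqc⟩, fun f hf ε hε => ?_⟩
  let g : Set.range Φ → ℝ := fun y => f.1 (Function.surjInv hqs y)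
  have hgq : g ∘ q = f.1 := by
    ext x
    exact hfactor f hf _ _ (Function.surjInv_eq hqs (q x))
  have hg : Continuous g := by
    rw [hq.continuous_iff, hgq]
    exact f.2
  obtain ⟨k, hk⟩ := (TopologicalSpace.denseRange_denseSeq C(Set.range Φ, ℝ)).exists_dist_lt
    ⟨g, hg⟩ hε
  refine ⟨k, fun x => ?_⟩
  have h := (ContinuousMap.dist_apply_le_dist (q x)).trans hk.le
  rw [Real.dist_eq] at h
  rwa [ContinuousMap.coe_mk, show g (q x) = f.1 x from congrFun hgq x] at h

theorem LinearMap.finiteDimensional_of_surjective_of_quotient_ker {E V : Type*} [AddCommGroup E]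
    [Module ℝ E] [AddCommGroup V] [Module ℝ V] (f : E →ₗ[ℝ] V) (hf : Function.Surjective f)
    (h : FiniteDimensional ℝ (E ⧸ LinearMap.ker f)) : FiniteDimensional ℝ V :=
  Module.Finite.equiv (f.quotKerEquivOfSurjective hf)

theorem Cp.finiteDimensional_of_closedComplemented {S : Submodule ℝ (Cp (StoneCech ℕ))}
    (hS : S.ClosedComplemented) [TopologicalSpace.SeparableSpace S] : FiniteDimensional ℝ S := by
  obtain ⟨P, hP⟩ := hS
  have hsurj : Function.Surjective P := fun s => ⟨s, hP s⟩
  obtain ⟨d, hd⟩ := Cp.exists_dense_seq_of_separableSpace S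
  refine LinearMap.finiteDimensional_of_surjective_of_quotient_ker P.toLinearMap hsurj
    (Cp.finiteDimensional_quotient_of_dense_seq (isClosed_singleton.preimage P.continuous) d
      fun f ε hε => ?_)
  obtain ⟨k, hk⟩ := hd (P f).1 (P f).2 ε hε
  refine ⟨k, f - (P f).1, ?_, fun x => ?_⟩
  · refine LinearMap.mem_ker.2 ?_
    refine (map_sub P _ _).trans ?_
    rw [hP, sub_self]
  · rw [show f - d k - (f - (P f).1) = (P f).1 - d k by abel]
    exact hk x

/-! ### The copy of c₀. -/

/-- Restriction of continuous functions on `βℕ` to `ℕ`. -/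
def Cp.restrictNat : Cp (StoneCech ℕ) →ₗ[ℝ] (ℕ → ℝ) where
  toFun f n := f.1 (stoneCechUnit n)
  map_add' _ _ := rfl
  map_smul' _ _ := rfl

theorem Cp.restrictNat_injective : Function.Injective Cp.restrictNat := fun f g h =>
  Subtype.ext (stoneCech_hom_ext f.2 g.2 h)

/-- The ultrafilter of a point outside ℕ is nonprincipal, hence finer than the cofinite filter. -/
theorem Cp.apply_eq_zero_of_tendsto {x : StoneCech ℕ} (hx : ∀ n, stoneCechUnit n ≠ x)
    {f : Cp (StoneCech ℕ)} (hf : Tendsto (Cp.restrictNat f) atTop (𝓝 0)) : f.1 x = 0 := by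
  rcases x.ultrafilter.le_cofinite_or_eq_pure with h | ⟨n, hn⟩
  · exact tendsto_nhds_unique (Cp.tendsto_ultrafilter f x)
      (hf.mono_left (h.trans Nat.cofinite_eq_atTop.le))
  · have h := x.tendsto_ultrafilter
    rw [hn] at h
    exact absurd (tendsto_nhds_unique (tendsto_pure_nhds _ n) h) (hx n)

theorem Cp.exists_subspace_equiv_cZero :
    ∃ S : Submodule ℝ (Cp (StoneCech ℕ)), Nonempty (S ≃L[ℝ] cZero) := by
  let S : Submodule ℝ (Cp (StoneCech ℕ)) := cZero.comap Cp.restrictNat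
  let R : S →ₗ[ℝ] cZero := Cp.restrictNat.restrict fun _ hf => hf
  have hR : Function.Bijective R := by
    refine ⟨fun f g h => Subtype.ext (Cp.restrictNat_injective (congrArg Subtype.val h)),
      fun y => ?_⟩
    obtain ⟨C, hC⟩ := (Metric.isBounded_range_of_tendsto y.1 y.2).exists_norm_le
    obtain ⟨f, hf⟩ := Cp.exists_extension (C := C) fun n => hC _ (Set.mem_range_self n)
    have hfy : Cp.restrictNat f = y.1 := funext hf
    exact ⟨⟨f, show Cp.restrictNat f ∈ cZero from hfy ▸ y.2⟩, Subtype.ext hfy⟩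
  let e : S ≃ₗ[ℝ] cZero := LinearEquiv.ofBijective R hR
  have hunit : ∀ (y : cZero) (n : ℕ), (e.symm y).1.1 (stoneCechUnit n) = y.1 n := fun y n =>
    congrFun (congrArg Subtype.val (e.apply_symm_apply y)) n
  refine ⟨S, ⟨{ e with continuous_toFun := ?_, continuous_invFun := ?_ }⟩⟩
  · have h : ∀ n, Continuous fun f : S => f.1.1 (stoneCechUnit n) := fun n =>
      (continuous_apply (stoneCechUnit n)).comp
        (continuous_subtype_val.comp continuous_subtype_val)
    exact (continuous_pi h).subtype_mk _
  · refine continuous_induced_rng.2 (continuous_induced_rng.2 (continuous_pi fun x => ?_))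
    change Continuous fun y => (e.symm y).1.1 x
    by_cases hx : ∃ n, stoneCechUnit n = x
    · obtain ⟨n, rfl⟩ := hx
      simp only [hunit]
      exact (continuous_apply n).comp continuous_subtype_val
    · push Not at hx
      have : ∀ y : cZero, (e.symm y).1.1 x = 0 := fun y =>
        Cp.apply_eq_zero_of_tendsto hx (e.symm y).2
      simp only [this]
      exact continuous_const

/-! ### The quotient ℓ_∞. -/

theorem Cp.exists_abs_le {X : Type*} [TopologicalSpace X] [CompactSpace X] (f : Cp X) :
    ∃ C : ℝ, ∀ x, |f.1 x| ≤ C := by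
  obtain ⟨C, hC⟩ := (isCompact_range (show Continuous f.1 from f.2)).isBounded.exists_norm_le
  exact ⟨C, fun x => hC _ (Set.mem_range_self x)⟩

/-- Weighted averages of a function on `βℕ` over finite blocks of `ℕ` of increasing length. -/
noncomputable def Cp.blockAverage : Cp (StoneCech ℕ) →ₗ[ℝ] ellInfty where
  toFun f := ⟨fun n => ∑ i ∈ Finset.range (n + 1),
      (1 / 2 : ℝ) ^ i * f.1 (stoneCechUnit (Nat.pair n i)), by
    obtain ⟨C, hC⟩ := Cp.exists_abs_le f
    refine ⟨2 * C, fun n => (Finset.abs_sum_le_sum_abs _ _).trans ?_⟩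
    calc ∑ i ∈ Finset.range (n + 1), |(1 / 2 : ℝ) ^ i * f.1 (stoneCechUnit (Nat.pair n i))|
        ≤ ∑ i ∈ Finset.range (n + 1), (1 / 2 : ℝ) ^ i * C := by
          refine Finset.sum_le_sum fun i _ => ?_
          rw [abs_mul, abs_of_pos (by positivity)]
          exact mul_le_mul_of_nonneg_left (hC _) (by positivity)
      _ ≤ 2 * C := by
          rw [← Finset.sum_mul]
          exact mul_le_mul_of_nonneg_right (sum_geometric_two_le _)
            ((abs_nonneg _).trans (hC (stoneCechUnit 0)))⟩
  map_add' f g := Subtype.ext <| funext fun n => by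
    simp [mul_add, Finset.sum_add_distrib]
  map_smul' c f := Subtype.ext <| funext fun n => by
    simp [Finset.mul_sum, mul_left_comm]

theorem Cp.blockAverage_apply (f : Cp (StoneCech ℕ)) (n : ℕ) :
    (Cp.blockAverage f).1 n = ∑ i ∈ Finset.range (n + 1),
      (1 / 2 : ℝ) ^ i * f.1 (stoneCechUnit (Nat.pair n i)) := rfl

theorem Cp.continuous_blockAverage : Continuous Cp.blockAverage := by
  refine (continuous_pi fun n => continuous_finsetSum _ fun i _ => ?_).subtype_mk _
  exact continuous_const.mul ((continuous_apply _).comp continuous_subtype_val)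

/-- Columns are pairwise disjoint, so each ultrafilter contains at most one. -/
theorem StoneCech.exists_column_notMem (F : Finset (StoneCech ℕ)) :
    ∃ j : ℕ, ∀ x ∈ F, {k : ℕ | (Nat.unpair k).2 = j} ∉ x.ultrafilter := by
  have hfin : (⋃ x ∈ F, {j : ℕ | {k : ℕ | (Nat.unpair k).2 = j} ∈ x.ultrafilter}).Finite := by
    refine Set.Finite.biUnion F.finite_toSet fun x _ => Set.Subsingleton.finite ?_
    intro i hi j hj
    obtain ⟨k, hki, hkj⟩ := x.ultrafilter.nonempty_of_mem (inter_mem hi hj)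
    exact hki.symm.trans hkj
  obtain ⟨j, hj⟩ := hfin.infinite_compl.nonempty
  simp only [Set.mem_compl_iff, Set.mem_iUnion, not_exists] at hj
  exact ⟨j, fun x hx => hj x hx⟩

/-- This gives openness: the lift is concentrated on a column invisible from `F`, apart from
finitely many rows where `y` is small. -/
theorem Cp.exists_blockAverage_eq (F : Finset (StoneCech ℕ)) :
    ∃ m : ℕ, ∀ (y : ellInfty) (ε : ℝ), 0 ≤ ε → (∀ n < m, |y.1 n| ≤ ε) →
      ∃ f : Cp (StoneCech ℕ), Cp.blockAverage f = y ∧ ∀ x ∈ F, |f.1 x| ≤ ε := by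
  obtain ⟨j, hj⟩ := StoneCech.exists_column_notMem F
  refine ⟨j, fun y ε hε hy => ?_⟩
  obtain ⟨C, hC⟩ := y.2
  have hC0 : 0 ≤ C := (abs_nonneg _).trans (hC 0)
  -- Block n contains column j only when j ≤ n; there 2^j cancels the weight. Shorter blocks use
  -- column 0, of weight 1.
  let w : ℕ → ℕ → ℝ := fun n i =>
    if n < j then (if i = 0 then y.1 n else 0) else (if i = j then 2 ^ j * y.1 n else 0)
  have hw : ∀ n i, |w n i| ≤ 2 ^ j * C := by
    intro n i
    have h1 : (1 : ℝ) ≤ 2 ^ j := one_le_pow₀ (by norm_num)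
    simp only [w]
    split_ifs
    · exact (hC n).trans (le_mul_of_one_le_left hC0 h1)
    · rw [abs_zero]
      positivity
    · rw [abs_mul, abs_of_pos (by positivity)]
      exact mul_le_mul_of_nonneg_left (hC n) (by positivity)
    · rw [abs_zero]
      positivity
  obtain ⟨f, hf⟩ := Cp.exists_extension (y := fun k => w (Nat.unpair k).1 (Nat.unpair k).2)
    fun k => hw _ _
  refine ⟨f, Subtype.ext (funext fun n => ?_), fun x hx => ?_⟩
  · rw [Cp.blockAverage_apply]
    simp only [hf, Nat.unpair_pair, w]
    by_cases hn : n < j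
    · simp [hn]
    · have hj' : j < n + 1 := by omega
      simp [hn, hj', ← mul_assoc]
  · refine Cp.abs_apply_le_of_mem_ultrafilter f
      (Ultrafilter.compl_mem_iff_notMem.2 (hj x hx)) fun k hk => ?_
    have hk' : (Nat.unpair k).2 ≠ j := hk
    rw [hf]
    simp only [w, if_neg hk']
    split_ifs with h1 h2
    · exact hy _ h1
    · simpa using hε
    · simpa using hε

theorem Cp.blockAverage_surjective : Function.Surjective Cp.blockAverage := by
  intro y
  obtain ⟨m, hm⟩ := Cp.exists_blockAverage_eq ∅
  obtain ⟨C, hC⟩ := y.2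
  obtain ⟨f, hf, -⟩ := hm y C ((abs_nonneg _).trans (hC 0)) fun n _ => hC n
  exact ⟨f, hf⟩

theorem Cp.isOpenMap_blockAverage : IsOpenMap Cp.blockAverage := by
  refine (IsTopologicalAddGroup.isOpenMap_iff_nhds_zero (f := Cp.blockAverage.toAddMonoidHom)).2 ?_
  intro V hV
  rw [mem_map, nhds_subtype_eq_comap, nhds_pi, mem_comap] at hV
  obtain ⟨t, ht, htV⟩ := hV
  obtain ⟨I, hI, s, hs, hst⟩ := Filter.mem_pi.1 ht
  obtain ⟨ε, hε, hεs⟩ := Metric.nhds_basis_closedBall.mem_iff.1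
    ((biInter_mem hI).2 fun x _ => hs x)
  obtain ⟨m, hm⟩ := Cp.exists_blockAverage_eq hI.toFinset
  have hev : ∀ᶠ y : ellInfty in 𝓝 0, ∀ n ∈ Finset.range m, |y.1 n| ≤ ε := by
    rw [Filter.eventually_all_finset]
    intro n _
    have hc : Continuous fun y : ellInfty => |y.1 n| :=
      ((continuous_apply n).comp continuous_subtype_val).abs
    have h0 : |(0 : ellInfty).1 n| < ε := by simpa using hε
    exact (hc.continuousAt.eventually_lt_const h0).mono fun _ h => h.le
  filter_upwards [hev] with y hy
  obtain ⟨f, rfl, hf⟩ := hm y ε hε.le fun n hn => hy n (Finset.mem_range.2 hn)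
  refine htV (show f.1 ∈ t from hst fun x hx => ?_)
  have hmem : f.1 x ∈ Metric.closedBall (0 : ℝ) ε := by
    simpa using hf x (hI.mem_toFinset.2 hx)
  exact Set.mem_iInter₂.1 (hεs hmem) x hx

theorem Cp.exists_quotient_equiv_ellInfty :
    ∃ Z : Submodule ℝ (Cp (StoneCech ℕ)), IsClosed (Z : Set (Cp (StoneCech ℕ))) ∧
      Nonempty ((Cp (StoneCech ℕ) ⧸ Z) ≃L[ℝ] ellInfty) := by
  let e := Cp.blockAverage.quotKerEquivOfSurjective Cp.blockAverage_surjective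
  refine ⟨LinearMap.ker Cp.blockAverage, isClosed_singleton.preimage Cp.continuous_blockAverage,
    ⟨{ e with continuous_toFun := ?_, continuous_invFun := ?_ }⟩⟩
  · refine (Submodule.isOpenQuotientMap_mkQ _).isQuotientMap.continuous_iff.2 ?_
    exact Cp.continuous_blockAverage
  · refine (Cp.isOpenMap_blockAverage.isQuotientMap Cp.continuous_blockAverage
      Cp.blockAverage_surjective).continuous_iff.2 ?_
    have : e.symm ∘ Cp.blockAverage = (LinearMap.ker Cp.blockAverage).mkQ :=
      funext fun f => e.symm_apply_apply ((LinearMap.ker Cp.blockAverage).mkQ f)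
    change Continuous (e.symm ∘ Cp.blockAverage)
    rw [this]
    exact continuous_quot_mk

theorem corollary2p4 :
    -- a quotient isomorphic to the space of bounded sequences
    (∃ Z : Submodule ℝ (Cp (StoneCech ℕ)), IsClosed (Z : Set (Cp (StoneCech ℕ))) ∧
      Nonempty ((Cp (StoneCech ℕ) ⧸ Z) ≃L[ℝ] ellInfty)) ∧
    -- a subspace isomorphic to the space of null sequences
    (∃ S : Submodule ℝ (Cp (StoneCech ℕ)), Nonempty (S ≃L[ℝ] cZero)) ∧
    -- no quotient isomorphic to the space of null sequences
    (¬ ∃ Z : Submodule ℝ (Cp (StoneCech ℕ)), IsClosed (Z : Set (Cp (StoneCech ℕ))) ∧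
      Nonempty ((Cp (StoneCech ℕ) ⧸ Z) ≃L[ℝ] cZero)) ∧
    -- no infinite-dimensional Polishable quotient
    (¬ ∃ Z : Submodule ℝ (Cp (StoneCech ℕ)), IsClosed (Z : Set (Cp (StoneCech ℕ))) ∧
      ¬ FiniteDimensional ℝ (Cp (StoneCech ℕ) ⧸ Z) ∧ IsPolishable (Cp (StoneCech ℕ) ⧸ Z)) ∧
    -- no complemented separable infinite-dimensional subspace
    (¬ ∃ S : Submodule ℝ (Cp (StoneCech ℕ)), S.ClosedComplemented ∧
      TopologicalSpace.SeparableSpace S ∧ ¬ FiniteDimensional ℝ S) :=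
  ⟨Cp.exists_quotient_equiv_ellInfty, Cp.exists_subspace_equiv_cZero,
    fun ⟨_, hZ, h⟩ => Cp.not_nonempty_quotient_equiv_cZero hZ h,
    fun ⟨_, hZ, hdim, h⟩ => hdim (Cp.finiteDimensional_quotient_of_isPolishable hZ h),
    fun ⟨_, hS, _, hdim⟩ => hdim (Cp.finiteDimensional_of_closedComplemented hS)⟩
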